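/- Let $\mathcal F$ be a germ of singular (holomorphic or formal) foliation at $(\mathbb C^2,0)$, given by a 1-form $\omega=P\,dx+Q\,dy$ with $P,Q\in\mathbb C[[x,y]]$ relatively prime and $P(0)=Q(0)=0$. Let $C: f=0$, $f\in\mathbb C[[x,y]]$, $f(0)=0$, be a reduced, possibly formal, curve of separatrices of $\mathcal F$: $f$ is square-free, and every irreducible factor $b$ of $f$ is $\mathcal F$-invariant, that is, $\omega\wedge db=(b\,k)\,dx\wedge dy$ for some $k\in\mathbb C[[x,y]]$. Put $$\tau(\mathcal F,C)=\dim_{\mathbb C}\mathbb C[[x,y]]/(f,P,Q),\qquad \tau(C)=\dim_{\mathbb C}\mathbb C[[x,y]]/(f,\partial_xf,\partial_yf),$$ and $i(u,v)=\dim_{\mathbb C}\mathbb C[[x,y]]/(u,v)$ for relatively prime $u,v$. The GSV-index $\mathrm{GSV}(\mathcal F,C)$ is defined by means of decompositions $g\omega=h\,df+f\eta$, with $\eta$ a formal 1-form and $g,h\in\mathbb C[[x,y]]$ both relatively prime to $f$, through the following rules: (i) if $f$, $g$, $h$ are convergent, then $\mathrm{GSV}(\mathcal F,C)=\frac1{2\pi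 i}\int_{\partial C}\frac gh\,d\!\left(\frac hg\right)$, where $\partial C$ is the union, over the branches of $C$, of the loops $\gamma(|t|=\varepsilon)$, with $\gamma$ a primitive analytic parametrization of the branch and $\varepsilon>0$ small; (ii) if $f$ is irreducible (possibly not convergent), then $\mathrm{GSV}(\mathcal F,C)=i(f,h)-i(f,g)$; (iii) if $C_1:f_1=0$ and $C_2:f_2=0$ have no common component, then $\mathrm{GSV}(\mathcal F,C_1\cup C_2)=\mathrm{GSV}(\mathcal F,C_1)+\mathrm{GSV}(\mathcal F,C_2)-2\,i(f_1,f_2)$. Then $\tau(\mathcal F,C)$ and $\tau(C)$ are finite, these rules assign to $C$ one and only one integer $\mathrm{GSV}(\mathcal F,C)$, and $$\tau(\mathcal F,C)-\tau(C)=\mathrm{GSV}(\mathcal F,C).$$ -/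

import Mathlib

open scoped Topology

noncomputable section

namespace PlaneFoliation

/-- The ring `ℂ⟦x, y⟧` of formal power series in two variables; `x` is variable `0` and
`y` is variable `1`. -/
abbrev R2 : Type := MvPowerSeries (Fin 2) ℂ

/-- The partial derivative `∂f/∂x`. -/
abbrev dx (f : R2) : R2 := MvPowerSeries.pderiv ℂ 0 f

/-- The partial derivative `∂f/∂y`. -/
abbrev dy (f : R2) : R2 := MvPowerSeries.pderiv ℂ 1 f

/-- A germ of singular (formal) foliation at the origin: a formal `1`-form `P dx + Q dy` with
relatively prime coefficients, both vanishing at the origin. -/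
structure SingularFoliation where
  P : R2
  Q : R2
  relPrime : IsRelPrime P Q
  singular_P : MvPowerSeries.constantCoeff P = 0
  singular_Q : MvPowerSeries.constantCoeff Q = 0

/-- The curve `f = 0` is invariant by `ω = P dx + Q dy`: one has `ω ∧ df = (f h) dx ∧ dy` for some
formal power series `h`. -/
def IsInvariant (F : SingularFoliation) (f : R2) : Prop :=
  ∃ h : R2, F.P * dy f - F.Q * dx f = f * h

/-- A (possibly purely formal) separatrix: an irreducible invariant curve. -/
def IsSeparatrix (F : SingularFoliation) (f : R2) : Prop :=
  Irreducible f ∧ IsInvariant F f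

/-- `f = 0` is a reduced curve through the origin all of whose irreducible components are
separatrices of the foliation. -/
structure IsCurveOfSeparatrices (F : SingularFoliation) (f : R2) : Prop where
  reduced : Squarefree f
  zero_mem : MvPowerSeries.constantCoeff f = 0
  isSeparatrix : ∀ b : R2, Irreducible b → b ∣ f → IsSeparatrix F b

/-- The intersection number `dim_ℂ ℂ⟦x, y⟧ / (f, g)`, used for relatively prime `f`, `g`. -/
def intersectionNumber (f g : R2) : ℕ :=
  Module.finrank ℂ (R2 ⧸ Ideal.span ({f, g} : Set R2))

/-- The Tjurina algebra `ℂ⟦x, y⟧ / (f, P, Q)` of the foliation along the curve `f = 0`. -/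
abbrev FoliationTjurinaAlgebra (F : SingularFoliation) (f : R2) : Type :=
  R2 ⧸ Ideal.span ({f, F.P, F.Q} : Set R2)

/-- The Tjurina algebra `ℂ⟦x, y⟧ / (f, ∂f/∂x, ∂f/∂y)` of the curve `f = 0`. -/
abbrev CurveTjurinaAlgebra (f : R2) : Type :=
  R2 ⧸ Ideal.span ({f, dx f, dy f} : Set R2)

/-- The Tjurina number of the foliation along the curve `f = 0`. -/
def foliationTjurina (F : SingularFoliation) (f : R2) : ℕ :=
  Module.finrank ℂ (FoliationTjurinaAlgebra F f)

/-- The Tjurina number of the curve `f = 0`. -/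
def curveTjurina (f : R2) : ℕ :=
  Module.finrank ℂ (CurveTjurinaAlgebra f)

/-- The pair `(g, h)` decomposes `ω = P dx + Q dy` along `f = 0`: `g` and `h` are relatively prime
to `f`, and `g ω = h df + f η` for some formal `1`-form `η = η₁ dx + η₂ dy`. -/
structure IsDecomposition (F : SingularFoliation) (f g h : R2) : Prop where
  relPrime_g : IsRelPrime f g
  relPrime_h : IsRelPrime f h
  eq : ∃ η₁ η₂ : R2, g * F.P = h * dx f + f * η₁ ∧ g * F.Q = h * dy f + f * η₂

/-- Membership in `ℂ{x, y}`: absolute convergence in some polydisc around the origin. -/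
def IsConvergent₂ (f : R2) : Prop :=
  ∃ r : ℝ, 0 < r ∧
    Summable fun n : Fin 2 →₀ ℕ => ‖MvPowerSeries.coeff n f‖ * r ^ (n 0 + n 1)

/-- Membership in `ℂ{t}`. -/
def IsConvergent₁ (φ : PowerSeries ℂ) : Prop :=
  ∃ r : ℝ, 0 < r ∧ Summable fun n : ℕ => ‖PowerSeries.coeff n φ‖ * r ^ n

/-- The value at `(x, y)` of the function defined by a convergent series in two variables. -/
def value₂ (f : R2) (x y : ℂ) : ℂ :=
  ∑' n : Fin 2 →₀ ℕ, MvPowerSeries.coeff n f * (x ^ n 0 * y ^ n 1)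

/-- The value at `t` of the function defined by a convergent series in one variable. -/
def value₁ (φ : PowerSeries ℂ) (t : ℂ) : ℂ :=
  ∑' n : ℕ, PowerSeries.coeff n φ * t ^ n

/-- `γ(t) = (γ₀(t), γ₁(t))` is a primitive analytic (Puiseux) parametrization of the branch
`b = 0`. Primitivity is expressed by saying that `γ* : ℂ⟦x, y⟧ / (b) → ℂ⟦t⟧` is the
normalization of the local ring of the branch: `γ*` has kernel `(b)`, and its image has finite
codimension in `ℂ⟦t⟧`. -/
structure IsParametrization (b : R2) (γ : Fin 2 → PowerSeries ℂ) : Prop where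
  centered : ∀ i, PowerSeries.constantCoeff (γ i) = 0
  convergent : ∀ i, IsConvergent₁ (γ i)
  ker : ∀ u : R2, MvPowerSeries.subst γ u = (0 : PowerSeries ℂ) ↔ b ∣ u
  finite_codim : Module.Finite ℂ
    (PowerSeries ℂ ⧸ Submodule.span ℂ
      (Set.range fun u : R2 => (MvPowerSeries.subst γ u : PowerSeries ℂ)))

/-- The function `t ↦ u(γ(t))`. -/
def pullback (γ : Fin 2 → PowerSeries ℂ) (u : R2) (t : ℂ) : ℂ :=
  value₂ u (value₁ (γ 0) t) (value₁ (γ 1) t)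

/-- The integral of the `1`-form `(g / h) d(h / g)` over the loop `t ↦ γ(t)`, `|t| = ε`. -/
def loopIntegral (g h : R2) (γ : Fin 2 → PowerSeries ℂ) (ε : ℝ) : ℂ :=
  ∮ t in C(0, ε), (pullback γ g t / pullback γ h t) *
    deriv (fun s : ℂ => pullback γ h s / pullback γ g s) t

/-- `IsGSVIndex F f n`: the number `n` is a value of the Gómez-Mont–Seade–Verjovsky index of the
foliation along the reduced curve of separatrices `f = 0`.

* `analytic`: if the curve is analytic, the index is `(2πi)⁻¹ ∫_{∂C} (g / h) d(h / g)` where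
  `g, h ∈ ℂ{x, y}` come from a decomposition `g ω = h df + f η`. The link `∂C` is the union of the
  loops `γᵢ(|t| = ε)`, `ε` small, one for each branch.
* `branch`: on a possibly purely formal separatrix, the index is `i(f, h) - i(f, g)`.
* `union`: the index of a union of two curves without common component is the sum of the indices
  minus twice the intersection number. -/
inductive IsGSVIndex (F : SingularFoliation) : R2 → ℤ → Prop
  | analytic {f g h : R2} {r : ℕ} {b : Fin r → R2} {γ : Fin r → Fin 2 → PowerSeries ℂ} {n : ℤ}
      (hf : IsCurveOfSeparatrices F f) (hd : IsDecomposition F f g h)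
      (hfc : IsConvergent₂ f) (hgc : IsConvergent₂ g) (hhc : IsConvergent₂ h)
      (hb : ∀ i, Irreducible (b i)) (hfb : f = ∏ i, b i)
      (hγ : ∀ i, IsParametrization (b i) (γ i))
      (hn : ∀ᶠ ε : ℝ in 𝓝[>] 0,
        (2 * (Real.pi : ℂ) * Complex.I)⁻¹ * ∑ i, loopIntegral g h (γ i) ε = (n : ℂ)) :
      IsGSVIndex F f n
  | branch {f g h : R2} (hf : IsSeparatrix F f) (hd : IsDecomposition F f g h) :
      IsGSVIndex F f ((intersectionNumber f h : ℤ) - (intersectionNumber f g : ℤ))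
  | union {f₁ f₂ : R2} {n₁ n₂ : ℤ} (h₁ : IsGSVIndex F f₁ n₁) (h₂ : IsGSVIndex F f₂ n₂)
      (h₁₂ : IsRelPrime f₁ f₂) :
      IsGSVIndex F (f₁ * f₂) (n₁ + n₂ - 2 * (intersectionNumber f₁ f₂ : ℤ))

end PlaneFoliation

end

noncomputable section

namespace PlaneFoliation

/-! ### The ring of formal power series in two variables -/

/-! For a decomposition `g ω = h df + f η`, the ideals `(f, gP, gQ)` and `(f, h ∂f/∂x, h ∂f/∂y)`
coincide. Multiplying the last two generators of `(f, a, b)` by a series prime to `f` raises the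
colength by its intersection number with `f` (`finrank_quotient_span_mul`). Computing the colength
of the common ideal in both ways gives `τ(F, C) + i(f, g) = τ(C) + i(f, h)`. Hence `i(f, h) - i(f,
g)` is the same for all decompositions and equals the difference of Tjurina numbers.

It remains to see that each rule returns this number; uniqueness of the index follows. For a branch
there is nothing more to do. For a union, a decomposition `(g, h)` along `f₁ f₂` restricts to `(g, h
f₂)` along `f₁` and to `(g, h f₁)` along `f₂`, and additivity of intersection numbers produces the
correction `-2 i(f₁, f₂)`. For the integral, the residue of `d log (h / g)` along a branch `b` is
the difference of the orders of `h` and `g` on the parametrization, that is `i(b, h) - i(b, g)` by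
`IsParametrization.intersectionNumber_eq`.

Existence comes from a decomposition built out of generic members of the pencils spanned by the
partial derivatives of `f` and by `P`, `Q`. -/

instance isPrincipalIdealRing_mvPowerSeries_fin_one :
    IsPrincipalIdealRing (MvPowerSeries (Fin 1) ℂ) :=
  have e : PowerSeries ℂ ≃ₐ[ℂ] MvPowerSeries (Fin 1) ℂ :=
    MvPowerSeries.renameEquiv ℂ (Equiv.ofUnique Unit (Fin 1))
  IsPrincipalIdealRing.of_surjective e.toRingEquiv e.surjective

/-- Power series in one variable over a principal ideal domain, here the power series in the other
variable, form a factorial ring. -/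
instance uniqueFactorizationMonoid_R2 : UniqueFactorizationMonoid R2 :=
  have : IsDomain (MvPowerSeries (Fin 1) ℂ) := NoZeroDivisors.to_isDomain _
  (MvPowerSeries.finSuccEquiv (n := 1) ℂ).symm.toMulEquiv.uniqueFactorizationMonoid inferInstance

theorem isUnit_iff_constantCoeff_ne_zero {f : R2} :
    IsUnit f ↔ MvPowerSeries.constantCoeff f ≠ 0 := by
  rw [MvPowerSeries.isUnit_iff_constantCoeff, isUnit_iff_ne_zero]

/-- A power series without monomials of bidegree less than `(N, N)` belongs to `(x ^ N, y ^ N)`. -/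
theorem mem_span_X_pow {N : ℕ} {f : R2}
    (hf : ∀ n : Fin 2 →₀ ℕ, n 0 < N → n 1 < N → MvPowerSeries.coeff n f = 0) :
    f ∈ Ideal.span ({MvPowerSeries.X 0 ^ N, MvPowerSeries.X 1 ^ N} : Set R2) := by
  classical
  let p : R2 := fun n => if N ≤ n 0 then MvPowerSeries.coeff n f else 0
  have hp : ∀ n, MvPowerSeries.coeff n p = if N ≤ n 0 then MvPowerSeries.coeff n f else 0 :=
    fun _ => rfl
  have h0 : (MvPowerSeries.X 0 : R2) ^ N ∣ p := by
    rw [MvPowerSeries.X_pow_dvd_iff]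
    intro m hm
    rw [hp, if_neg (not_le.mpr hm)]
  have h1 : (MvPowerSeries.X 1 : R2) ^ N ∣ f - p := by
    rw [MvPowerSeries.X_pow_dvd_iff]
    intro m hm
    rw [map_sub, hp]
    split_ifs with h
    · exact sub_self _
    · rw [hf m (not_le.mp h) hm, sub_zero]
  obtain ⟨a, ha⟩ := h0
  obtain ⟨b, hb⟩ := h1
  rw [Ideal.mem_span_pair]
  exact ⟨a, b, by rw [mul_comm a, mul_comm b, ← ha, ← hb]; ring⟩

theorem mem_span_X_of_not_isUnit {f : R2} (hf : ¬ IsUnit f) :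
    f ∈ Ideal.span ({MvPowerSeries.X 0, MvPowerSeries.X 1} : Set R2) := by
  rw [isUnit_iff_constantCoeff_ne_zero, not_not] at hf
  have := mem_span_X_pow (N := 1) (f := f) fun n h0 h1 => by
    have : n = 0 := by
      ext i
      fin_cases i
      · simpa using h0
      · simpa using h1
    rw [this]
    exact hf
  simpa using this

/-- An ideal containing `x ^ N` and `y ^ N` has finite colength. -/
theorem finite_quotient_of_X_pow_mem {I : Ideal R2} {N : ℕ}
    (h0 : (MvPowerSeries.X 0 : R2) ^ N ∈ I) (h1 : (MvPowerSeries.X 1 : R2) ^ N ∈ I) :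
    Module.Finite ℂ (R2 ⧸ I) := by
  let T : R2 →ₗ[ℂ] (Fin N × Fin N → ℂ) := LinearMap.pi fun ij =>
    MvPowerSeries.coeff (Finsupp.single 0 (ij.1 : ℕ) + Finsupp.single 1 (ij.2 : ℕ))
  have hT : LinearMap.ker T ≤ I.restrictScalars ℂ := by
    intro f hf
    refine Ideal.span_le.mpr ?_ (mem_span_X_pow (N := N) (f := f) fun n hn0 hn1 => ?_)
    · rintro _ (rfl | rfl)
      exacts [h0, h1]
    · have := congrFun hf (⟨n 0, hn0⟩, ⟨n 1, hn1⟩)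
      have hn : Finsupp.single 0 (n 0) + Finsupp.single 1 (n 1) = n := by
        ext i
        fin_cases i <;> simp
      simpa [T, hn] using this
  have : Module.Finite ℂ (R2 ⧸ LinearMap.ker T) :=
    Module.Finite.equiv T.quotKerEquivRange.symm
  exact Module.Finite.of_surjective (Submodule.mapQ (LinearMap.ker T) (I.restrictScalars ℂ)
    LinearMap.id hT) fun z => by
      obtain ⟨f, rfl⟩ := Submodule.Quotient.mk_surjective _ z
      exact ⟨Submodule.Quotient.mk f, rfl⟩

/-- Dimension two: a prime factor `q` of `u` lies in `p`, and `(q) ≠ p` since `q` cannot divide both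
`u` and `v`. If `p` were not maximal, the chain `0 < (q) < p < m` would give height at least 3 to an
ideal `m` with two generators, against Krull's height theorem. -/
theorem eq_span_X_of_isRelPrime_mem {u v : R2} (huv : IsRelPrime u v) {p : Ideal R2}
    [hp : p.IsPrime] (hu : u ∈ p) (hv : v ∈ p) :
    p = Ideal.span ({MvPowerSeries.X 0, MvPowerSeries.X 1} : Set R2) := by
  set m : Ideal R2 := Ideal.span ({MvPowerSeries.X 0, MvPowerSeries.X 1} : Set R2) with hm
  have hmcc : ∀ f ∈ m, MvPowerSeries.constantCoeff f = 0 := by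
    intro f hf
    obtain ⟨a, b, rfl⟩ := Ideal.mem_span_pair.mp hf
    simp
  have hmem : ∀ f : R2, f ∈ m ↔ ¬ IsUnit f := fun f =>
    ⟨fun h hu => isUnit_iff_constantCoeff_ne_zero.mp hu (hmcc f h), mem_span_X_of_not_isUnit⟩
  have hpm : p ≤ m := fun f hf => (hmem f).mpr fun hu => hp.ne_top (Ideal.eq_top_of_isUnit_mem _ hf hu)
  have hmne : m ≠ ⊤ := fun h => (hmem 1).mp (h ▸ Submodule.mem_top) isUnit_one
  by_contra hne
  have hlt : p < m := lt_of_le_of_ne hpm hne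
  have hmprime : m.IsPrime := by
    have : m = IsLocalRing.maximalIdeal R2 := by
      ext f
      rw [hmem, IsLocalRing.mem_maximalIdeal, mem_nonunits_iff]
    rw [this]
    infer_instance
  have hnu : ∀ f ∈ p, ¬ IsUnit f := fun f hf => (hmem f).mp (hpm hf)
  have hu0 : u ≠ 0 := by
    rintro rfl
    exact hnu v hv (huv (dvd_zero v) dvd_rfl)
  obtain ⟨q, hq, hqp⟩ : ∃ q : R2, Prime q ∧ q ∈ p := by
    by_contra! h
    have hprod := UniqueFactorizationMonoid.exists_prime_factors u hu0
    obtain ⟨s, hs, w, hw⟩ := hprod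
    have : s.prod ∈ p := by
      have : s.prod * w ∈ p := hw ▸ hu
      exact (hp.mem_or_mem this).resolve_right fun h => hnu _ h w.isUnit
    obtain ⟨q, hqs, hqp⟩ := (hp.multiset_prod_mem_iff_exists_mem s).mp this
    exact h q (hs q hqs) hqp
  have hqprime : (Ideal.span {q} : Ideal R2).IsPrime :=
    (Ideal.span_singleton_prime hq.ne_zero).mpr hq
  have hqlt : Ideal.span {q} < p := by
    refine lt_of_le_of_ne ((Ideal.span_singleton_le_iff_mem p).mpr hqp) ?_
    rintro rfl
    exact hq.not_isUnit (huv (Ideal.mem_span_singleton.mp hu) (Ideal.mem_span_singleton.mp hv))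
  have hbot : (⊥ : Ideal R2) < Ideal.span {q} := by
    rw [bot_lt_iff_ne_bot, Ne, Ideal.span_singleton_eq_bot]
    exact hq.ne_zero
  have : (⊥ : Ideal R2).IsPrime := Ideal.isPrime_bot
  have l1 := Ideal.height_add_one_le_of_lt_of_isPrime hbot
  have l2 := Ideal.height_add_one_le_of_lt_of_isPrime hqlt
  have l3 := Ideal.height_add_one_le_of_lt_of_isPrime hlt
  have l4 : m.height ≤ 2 := by
    obtain ⟨P, hP⟩ := Ideal.nonempty_minimalPrimes hmne
    refine (Ideal.height_mono hP.1.2).trans ?_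
    have := Ideal.height_le_card_of_mem_minimalPrimes_span 
      (s := {MvPowerSeries.X 0, MvPowerSeries.X 1}) (Set.toFinite _) hP
    refine this.trans ?_
    exact_mod_cast (Set.ncard_insert_le _ _).trans (by simp)
  have l5 : (3 : ℕ∞) ≤ m.height := calc
    (3 : ℕ∞) = 0 + 1 + 1 + 1 := by norm_num
    _ ≤ (⊥ : Ideal R2).height + 1 + 1 + 1 := by gcongr; exact zero_le
    _ ≤ m.height := by
      refine le_trans ?_ l3
      gcongr
      refine le_trans ?_ l2
      gcongr
  exact absurd (l5.trans l4) (by norm_num)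

/-- Two relatively prime power series in two variables span an ideal of finite colength. -/
theorem finite_quotient_span_pair {u v : R2} (huv : IsRelPrime u v) :
    Module.Finite ℂ (R2 ⧸ Ideal.span ({u, v} : Set R2)) := by
  set I : Ideal R2 := Ideal.span {u, v}
  -- The radical is the intersection of the primes above `I`, and the only possible one is `(x, y)`.
  have hX : ∀ i : Fin 2, (MvPowerSeries.X i : R2) ∈ I.radical := by
    intro i
    rw [Ideal.radical_eq_sInf, Ideal.mem_sInf]
    rintro p ⟨hIp, hp⟩
    rw [eq_span_X_of_isRelPrime_mem huv (hIp (Ideal.subset_span (Set.mem_insert _ _)))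
      (hIp (Ideal.subset_span (Set.mem_insert_of_mem _ rfl)))]
    apply Ideal.subset_span
    fin_cases i <;> simp
  obtain ⟨a, ha⟩ := hX 0
  obtain ⟨b, hb⟩ := hX 1
  exact finite_quotient_of_X_pow_mem (N := a + b) (by rw [pow_add]; exact I.mul_mem_right _ ha)
    (by rw [pow_add]; exact I.mul_mem_left _ hb)

theorem finite_quotient_of_le {I J : Ideal R2} (h : I ≤ J) [Module.Finite ℂ (R2 ⧸ I)] :
    Module.Finite ℂ (R2 ⧸ J) :=
  Module.Finite.of_surjective (Ideal.Quotient.factorₐ ℂ h).toLinearMap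
    (Ideal.Quotient.factor_surjective h)

/-! ### Additivity of colengths -/

section LinearAlgebra

variable {K U V : Type*} [Field K] [AddCommGroup U] [Module K U] [AddCommGroup V] [Module K V]

/-- The codimension of a subspace `Z ≤ V`, computed by means of a linear map `T : U → V`. -/
theorem finrank_quotient_eq_comap_add (T : U →ₗ[K] V) (Z : Submodule K V)
    [hU : Module.Finite K (U ⧸ Z.comap T)] [hV : Module.Finite K (V ⧸ (Z ⊔ LinearMap.range T))] :
    Module.Finite K (V ⧸ Z) ∧ Module.finrank K (V ⧸ Z) =
      Module.finrank K (U ⧸ Z.comap T) + Module.finrank K (V ⧸ (Z ⊔ LinearMap.range T)) := by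
  -- The maps `i` and `p` form a short exact sequence `0 → U/T⁻¹Z → V/Z → V/(Z + im T) → 0`.
  let i : (U ⧸ Z.comap T) →ₗ[K] V ⧸ Z := (Z.comap T).mapQ Z T le_rfl
  let p : (V ⧸ Z) →ₗ[K] V ⧸ (Z ⊔ LinearMap.range T) := Submodule.factor le_sup_left
  have hi : Function.Injective i := by
    rw [← LinearMap.ker_eq_bot, eq_bot_iff]
    intro w hw
    obtain ⟨u, rfl⟩ := Submodule.Quotient.mk_surjective _ w
    exact (Submodule.Quotient.mk_eq_zero _).mpr ((Submodule.Quotient.mk_eq_zero Z).mp hw)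
  have hp : Function.Surjective p := Submodule.factor_surjective _
  have hip : LinearMap.range i = LinearMap.ker p := by
    ext z
    obtain ⟨v, rfl⟩ := Submodule.Quotient.mk_surjective _ z
    have hpv : p (Submodule.Quotient.mk v) = 0 ↔ v ∈ Z ⊔ LinearMap.range T :=
      Submodule.Quotient.mk_eq_zero _
    rw [LinearMap.mem_ker, hpv, Submodule.mem_sup]
    constructor
    · rintro ⟨w, hw⟩
      obtain ⟨u, rfl⟩ := Submodule.Quotient.mk_surjective _ w
      have : v - T u ∈ Z := (Submodule.Quotient.eq Z).mp hw.symm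
      exact ⟨v - T u, this, T u, ⟨u, rfl⟩, sub_add_cancel _ _⟩
    · rintro ⟨z, hz, _, ⟨u, rfl⟩, rfl⟩
      refine ⟨Submodule.Quotient.mk u, (Submodule.Quotient.eq Z).mpr ?_⟩
      simpa using hz
  have hk : Module.Finite K (LinearMap.ker p) := by
    rw [← hip]
    infer_instance
  have hq : Module.Finite K ((V ⧸ Z) ⧸ LinearMap.ker p) :=
    Module.Finite.equiv (p.quotKerEquivOfSurjective hp).symm
  have hfin : Module.Finite K (V ⧸ Z) := Module.Finite.of_submodule_quotient (LinearMap.ker p)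
  refine ⟨hfin, ?_⟩
  have h := LinearMap.finrank_range_add_finrank_ker p
  rw [← hip, LinearMap.finrank_range_of_inj hi, LinearMap.range_eq_top.mpr hp, finrank_top] at h
  omega

end LinearAlgebra

/-- The colength of `(f, g a, g b)` when `g` is relatively prime to `f`. -/
theorem finrank_quotient_span_mul {f g : R2} (hfg : IsRelPrime f g) (a b : R2)
    [Module.Finite ℂ (R2 ⧸ Ideal.span ({f, a, b} : Set R2))] :
    Module.finrank ℂ (R2 ⧸ Ideal.span ({f, g * a, g * b} : Set R2)) =
      Module.finrank ℂ (R2 ⧸ Ideal.span ({f, a, b} : Set R2)) + intersectionNumber f g := by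
  -- For multiplication by `g`, the preimage of `(f, ga, gb)` is `(f, a, b)`, because `g` can be
  -- cancelled modulo `f`; adding the image gives `(f, g)`.
  let T : R2 →ₗ[ℂ] R2 := LinearMap.mulLeft ℂ g
  let Z : Submodule ℂ R2 := (Ideal.span ({f, g * a, g * b} : Set R2)).restrictScalars ℂ
  have h1 : Z.comap T = (Ideal.span ({f, a, b} : Set R2)).restrictScalars ℂ := by
    ext r
    simp only [Submodule.mem_comap, Z, T, Submodule.restrictScalars_mem, LinearMap.mulLeft_apply,
      Ideal.mem_span_insert, Ideal.mem_span_singleton']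
    constructor
    · rintro ⟨u, _, ⟨v, _, ⟨w, rfl⟩, rfl⟩, hr⟩
      have : f ∣ g * (r - (v * a + w * b)) := ⟨u, by linear_combination hr⟩
      obtain ⟨t, ht⟩ := hfg.dvd_of_dvd_mul_left this
      exact ⟨t, _, ⟨v, _, ⟨w, rfl⟩, rfl⟩, by linear_combination ht⟩
    · rintro ⟨u, _, ⟨v, _, ⟨w, rfl⟩, rfl⟩, rfl⟩
      exact ⟨g * u, _, ⟨v, _, ⟨w, rfl⟩, rfl⟩, by ring⟩
  have h2 : Z ⊔ LinearMap.range T = (Ideal.span ({f, g} : Set R2)).restrictScalars ℂ := by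
    ext r
    simp only [Submodule.mem_sup, Z, T, Submodule.restrictScalars_mem, LinearMap.mem_range,
      LinearMap.mulLeft_apply, Ideal.mem_span_insert, Ideal.mem_span_singleton']
    constructor
    · rintro ⟨_, ⟨u, _, ⟨v, _, ⟨w, rfl⟩, rfl⟩, rfl⟩, _, ⟨s, rfl⟩, rfl⟩
      exact ⟨u, _, ⟨v * a + w * b + s, rfl⟩, by ring⟩
    · rintro ⟨u, _, ⟨v, rfl⟩, rfl⟩
      exact ⟨u * f, ⟨u, _, ⟨0, _, ⟨0, rfl⟩, rfl⟩, by ring⟩, _, ⟨v, rfl⟩, by ring⟩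
  have f1 : Module.Finite ℂ (R2 ⧸ Z.comap T) := by
    rw [h1]
    assumption
  have f2 : Module.Finite ℂ (R2 ⧸ (Z ⊔ LinearMap.range T)) := by
    rw [h2]
    exact finite_quotient_span_pair hfg
  have := (finrank_quotient_eq_comap_add T Z).2
  rw [h1, h2] at this
  exact this

theorem intersectionNumber_comm (f g : R2) : intersectionNumber f g = intersectionNumber g f := by
  rw [intersectionNumber, intersectionNumber, Set.pair_comm]

theorem intersectionNumber_mul_right {f g h : R2} (hg : IsRelPrime f g) (hh : IsRelPrime f h) :
    intersectionNumber f (g * h) = intersectionNumber f g + intersectionNumber f h := by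
  have : Module.Finite ℂ (R2 ⧸ Ideal.span ({f, h, h} : Set R2)) := by
    rw [Set.pair_eq_singleton]
    exact finite_quotient_span_pair hh
  have := finrank_quotient_span_mul hg h h
  rw [Set.pair_eq_singleton, Set.pair_eq_singleton] at this
  rw [add_comm]
  exact this

theorem intersectionNumber_mul_left {f g h : R2} (hf : IsRelPrime f h) (hg : IsRelPrime g h) :
    intersectionNumber (f * g) h = intersectionNumber f h + intersectionNumber g h := by
  rw [intersectionNumber_comm, intersectionNumber_mul_right hf.symm hg.symm,
    intersectionNumber_comm h, intersectionNumber_comm h]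

theorem intersectionNumber_of_isUnit_left {f g : R2} (hf : IsUnit f) :
    intersectionNumber f g = 0 := by
  have : Ideal.span ({f, g} : Set R2) = ⊤ :=
    Ideal.eq_top_of_isUnit_mem _ (Ideal.subset_span (Set.mem_insert _ _)) hf
  rw [intersectionNumber, this]
  exact Module.finrank_zero_of_subsingleton

theorem intersectionNumber_prod_left {ι : Type*} (s : Finset ι) (b : ι → R2) {g : R2}
    (h : ∀ i ∈ s, IsRelPrime (b i) g) :
    intersectionNumber (∏ i ∈ s, b i) g = ∑ i ∈ s, intersectionNumber (b i) g := by
  classical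
  induction s using Finset.induction_on with
  | empty => simpa using intersectionNumber_of_isUnit_left isUnit_one
  | insert a s ha ih =>
    rw [Finset.prod_insert ha, Finset.sum_insert ha, intersectionNumber_mul_left
      (h a (Finset.mem_insert_self a s))
      (IsRelPrime.prod_left fun i hi => h i (Finset.mem_insert_of_mem hi)),
      ih fun i hi => h i (Finset.mem_insert_of_mem hi)]

/-! ### Intersection numbers and parametrizations -/

/-- Up to a unit `φ` is `X ^ m`, so its multiples are the kernel of the map reading off the first
`m` coefficients. -/
theorem finrank_quotient_range_mulLeft {φ : PowerSeries ℂ} (hφ : φ ≠ 0) :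
    Module.Finite ℂ (PowerSeries ℂ ⧸ LinearMap.range (LinearMap.mulLeft ℂ φ)) ∧
      Module.finrank ℂ (PowerSeries ℂ ⧸ LinearMap.range (LinearMap.mulLeft ℂ φ)) =
        φ.order.toNat := by
  set m := φ.order.toNat
  obtain ⟨u, hu⟩ : ∃ u : PowerSeries ℂ, φ * u = PowerSeries.X ^ m := by
    have h := PowerSeries.X_pow_order_mul_divXPowOrder (f := φ)
    have hc : PowerSeries.constantCoeff (PowerSeries.divXPowOrder φ) ≠ 0 := by
      rwa [Ne, PowerSeries.constantCoeff_divXPowOrder_eq_zero_iff]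
    refine ⟨(PowerSeries.divXPowOrder φ)⁻¹, ?_⟩
    calc φ * (PowerSeries.divXPowOrder φ)⁻¹
        = PowerSeries.X ^ m * (PowerSeries.divXPowOrder φ * (PowerSeries.divXPowOrder φ)⁻¹) := by
          rw [← mul_assoc, h]
      _ = PowerSeries.X ^ m := by rw [PowerSeries.mul_inv_cancel _ hc, mul_one]
  let T : PowerSeries ℂ →ₗ[ℂ] (Fin m → ℂ) := LinearMap.pi fun i => PowerSeries.coeff (i : ℕ)
  have hT : LinearMap.ker T = LinearMap.range (LinearMap.mulLeft ℂ φ) := by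
    ext ψ
    have h1 : ψ ∈ LinearMap.ker T ↔ PowerSeries.X ^ m ∣ ψ := by
      rw [PowerSeries.X_pow_dvd_iff, LinearMap.mem_ker]
      exact ⟨fun h i hi => congrFun h ⟨i, hi⟩, fun h => funext fun i => h i i.2⟩
    rw [h1, LinearMap.mem_range]
    constructor
    · rintro ⟨v, rfl⟩
      exact ⟨u * v, by rw [LinearMap.mulLeft_apply, ← mul_assoc, hu]⟩
    · rintro ⟨v, rfl⟩
      exact (PowerSeries.X_pow_order_dvd).mul_right v
  have hs : Function.Surjective T := fun c =>
    ⟨PowerSeries.mk fun n => if h : n < m then c ⟨n, h⟩ else 0, by ext i; simp [T]⟩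
  have e := T.quotKerEquivOfSurjective hs
  rw [hT] at e
  exact ⟨Module.Finite.equiv e.symm, by rw [e.finrank_eq, Module.finrank_fin_fun]⟩

theorem IsParametrization.hasSubst {b : R2} {γ : Fin 2 → PowerSeries ℂ}
    (hγ : IsParametrization b γ) : MvPowerSeries.HasSubst γ :=
  MvPowerSeries.hasSubst_of_constantCoeff_zero hγ.centered

/-- The intersection number of a branch with a curve `g = 0` is the order of `g` along a primitive
parametrization of the branch. -/
theorem IsParametrization.intersectionNumber_eq {b g : R2} {γ : Fin 2 → PowerSeries ℂ}
    (hγ : IsParametrization b γ) (hbg : IsRelPrime b g)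
    (h0 : (MvPowerSeries.subst γ g : PowerSeries ℂ) ≠ 0) :
    intersectionNumber b g = (PowerSeries.order (MvPowerSeries.subst γ g)).toNat := by
  let S : R2 →ₐ[ℂ] PowerSeries ℂ := MvPowerSeries.substAlgHom hγ.hasSubst
  have hS : ∀ u, S u = MvPowerSeries.subst γ u := fun u => by
    simp [S]
  set G : PowerSeries ℂ := MvPowerSeries.subst γ g with hG
  let I : Submodule ℂ R2 := (Ideal.span ({b, g} : Set R2)).restrictScalars ℂ
  let M : PowerSeries ℂ →ₗ[ℂ] PowerSeries ℂ := LinearMap.mulLeft ℂ G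
  let A : Submodule ℂ (PowerSeries ℂ) := LinearMap.range S.toLinearMap
  -- With `A` the image of `γ*`, the codimension of `G · A` in `ℂ⟦t⟧` is computed twice: through
  -- `γ*` it is `i(b, g) + codim A`, through multiplication by `G` it is `codim A + ord G`. The
  -- finite number `codim A` cancels.
  let Z : Submodule ℂ (PowerSeries ℂ) := A.map M
  have hM : Function.Injective M := fun u v huv => mul_left_cancel₀ h0 huv
  have hA : Module.Finite ℂ (PowerSeries ℂ ⧸ A) := by
    have h := hγ.finite_codim
    have : Set.range (fun u : R2 => (MvPowerSeries.subst γ u : PowerSeries ℂ)) = A := by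
      ext ψ
      simp [A, hS]
    rwa [this, Submodule.span_eq] at h
  have hker : ∀ u : R2, S u = 0 ↔ b ∣ u := fun u => by rw [hS]; exact hγ.ker u
  have e1 : Z.comap S.toLinearMap = I := by
    ext r
    simp only [Z, A, I, M, Submodule.mem_comap, Submodule.mem_map, LinearMap.mem_range,
      AlgHom.toLinearMap_apply, Submodule.restrictScalars_mem, Ideal.mem_span_pair,
      LinearMap.mulLeft_apply]
    constructor
    · rintro ⟨_, ⟨v, rfl⟩, hv⟩
      have : S (r - v * g) = 0 := by
        rw [map_sub, map_mul, ← hv, hS g, ← hG]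
        ring
      obtain ⟨u, hu⟩ := (hker _).mp this
      exact ⟨u, v, by linear_combination -hu⟩
    · rintro ⟨u, v, rfl⟩
      refine ⟨_, ⟨v, rfl⟩, ?_⟩
      have : S b = 0 := (hker b).mpr dvd_rfl
      rw [map_add, map_mul, map_mul, this, hS g, ← hG]
      ring
  have e2 : Z ⊔ LinearMap.range S.toLinearMap = A := by
    refine sup_eq_right.mpr ?_
    rintro _ ⟨_, ⟨v, rfl⟩, rfl⟩
    exact ⟨g * v, by rw [AlgHom.toLinearMap_apply, map_mul, hS g]; rfl⟩
  have e3 : Z.comap M = A := Submodule.comap_map_eq_of_injective hM A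
  have e4 : Z ⊔ LinearMap.range M = LinearMap.range M :=
    sup_eq_right.mpr LinearMap.map_le_range
  obtain ⟨f4, n4⟩ := finrank_quotient_range_mulLeft h0
  have i1 : Module.Finite ℂ (R2 ⧸ Z.comap S.toLinearMap) := by
    rw [e1]
    exact finite_quotient_span_pair hbg
  have i2 : Module.Finite ℂ (PowerSeries ℂ ⧸ (Z ⊔ LinearMap.range S.toLinearMap)) := by
    rwa [e2]
  have i3 : Module.Finite ℂ (PowerSeries ℂ ⧸ Z.comap M) := by rwa [e3]
  have i4 : Module.Finite ℂ (PowerSeries ℂ ⧸ (Z ⊔ LinearMap.range M)) := by rwa [e4]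
  have k1 := (finrank_quotient_eq_comap_add S.toLinearMap Z).2
  have k2 := (finrank_quotient_eq_comap_add M Z).2
  rw [e1, e2] at k1
  rw [e3, e4, n4] at k2
  have : intersectionNumber b g = Module.finrank ℂ (R2 ⧸ I) := rfl
  omega

/-! ### Decompositions of a foliation along a curve of separatrices -/

theorem dx_mul (a b : R2) : dx (a * b) = a * dx b + b * dx a := by
  simp [dx, Derivation.leibniz]

theorem dy_mul (a b : R2) : dy (a * b) = a * dy b + b * dy a := by
  simp [dy, Derivation.leibniz]

/-- In characteristic zero some partial derivative of a nonzero non-unit has smaller order. -/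
theorem exists_not_dvd_pderiv {p : R2} (hp0 : p ≠ 0) (hp : ¬ IsUnit p) :
    ∃ i : Fin 2, ¬ p ∣ MvPowerSeries.pderiv ℂ i p := by
  rw [isUnit_iff_constantCoeff_ne_zero, not_not] at hp
  obtain ⟨d, hd, hdo⟩ := MvPowerSeries.exists_coeff_ne_zero_and_order
    (MvPowerSeries.ne_zero_iff_order_finite.mp hp0)
  have hd0 : d ≠ 0 := by
    rintro rfl
    exact hd hp
  obtain ⟨i, hi⟩ := Finsupp.ne_iff.mp hd0
  refine ⟨i, fun hdvd => ?_⟩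
  have hle : Finsupp.single i 1 ≤ d := by
    rw [Finsupp.single_le_iff]
    exact Nat.one_le_iff_ne_zero.mpr hi
  set e := d - Finsupp.single i 1 with he
  have hed : e + Finsupp.single i 1 = d := tsub_add_cancel_of_le hle
  -- Differentiating a monomial of lowest degree only multiplies its coefficient by the positive
  -- integer `e i + 1`, so the derivative has order below that of `p`.
  have hc : MvPowerSeries.coeff e (MvPowerSeries.pderiv ℂ i p) ≠ 0 := by
    rw [MvPowerSeries.coeff_pderiv, hed]
    exact mul_ne_zero hd (by exact_mod_cast Nat.succ_ne_zero (e i))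
  have h1 := MvPowerSeries.order_le hc
  obtain ⟨c, hc'⟩ := hdvd
  rw [hc', MvPowerSeries.order_mul] at h1
  have h2 : MvPowerSeries.order p ≤ ((Finsupp.degree e : ℕ) : ℕ∞) :=
    le_self_add.trans h1
  rw [← hdo, ← hed, map_add, Finsupp.degree_single] at h2
  exact absurd (Nat.cast_le.mp h2) (by omega)

/-- With `f = p q` and `p ∤ q`, each partial derivative of `f` is congruent modulo `p` to `q` times
that of `p`; so `p` would divide both of its own partial derivatives. -/
theorem not_dvd_dx_and_dvd_dy {f p : R2} (hf : Squarefree f) (hp : Prime p) (hpf : p ∣ f) :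
    ¬ (p ∣ dx f ∧ p ∣ dy f) := by
  obtain ⟨q, rfl⟩ := hpf
  have hq : ¬ p ∣ q := fun h => hp.not_isUnit (hf p (mul_dvd_mul_left p h))
  rintro ⟨h0, h1⟩
  rw [dx_mul, dvd_add_right (dvd_mul_right _ _)] at h0
  rw [dy_mul, dvd_add_right (dvd_mul_right _ _)] at h1
  obtain ⟨i, hi⟩ := exists_not_dvd_pderiv hp.ne_zero hp.not_isUnit
  apply hi
  fin_cases i
  · exact (hp.dvd_or_dvd h0).resolve_left hq
  · exact (hp.dvd_or_dvd h1).resolve_left hq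

theorem isRelPrime_of_forall_prime {f g : R2} (hf : f ≠ 0)
    (h : ∀ p, Prime p → p ∣ f → ¬ p ∣ g) : IsRelPrime f g := by
  intro d hdf hdg
  by_contra hd
  have hd0 : d ≠ 0 := ne_zero_of_dvd_ne_zero hf hdf
  obtain ⟨p, hp, hpd⟩ := WfDvdMonoid.exists_irreducible_factor hd hd0
  exact h p hp.prime (hpd.trans hdf) (hpd.trans hdg)

/-- All but finitely many members of the pencil `u + t v` are relatively prime to `f`, if no
component of `f` is a common component of `u` and `v`. -/
theorem finite_setOf_not_isRelPrime {f u v : R2} (hf : f ≠ 0)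
    (h : ∀ p, Prime p → p ∣ f → ¬ (p ∣ u ∧ p ∣ v)) :
    {t : ℂ | ¬ IsRelPrime f (u + MvPowerSeries.C t * v)}.Finite := by
  classical
  refine Set.Finite.subset (Set.Finite.biUnion
    (UniqueFactorizationMonoid.factors f).toFinset.finite_toSet
    (t := fun p => {t : ℂ | p ∣ u + MvPowerSeries.C t * v}) fun p hp => ?_) fun t ht => ?_
  · rw [Finset.mem_coe, Multiset.mem_toFinset] at hp
    have hpp := UniqueFactorizationMonoid.prime_of_factor p hp
    have hpf := UniqueFactorizationMonoid.dvd_of_mem_factors hp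
    -- Each prime factor excludes at most one `t`: from two members of the pencil divisible by `p`,
    -- both `v` and `u` would be divisible by `p`.
    refine Set.Subsingleton.finite fun t ht s hs => ?_
    by_contra hts
    have hd : p ∣ MvPowerSeries.C (t - s) * v := by
      have := dvd_sub ht hs
      rw [map_sub]
      convert this using 1
      ring
    have hu : IsUnit (MvPowerSeries.C (t - s) : R2) :=
      (isUnit_iff_ne_zero.mpr (sub_ne_zero.mpr hts)).map _
    have hv : p ∣ v := (hu.dvd_mul_left).mp hd
    exact h p hpp hpf ⟨(dvd_add_left (hv.mul_left _)).mp ht, hv⟩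
  · by_contra hc
    simp only [Set.mem_iUnion, not_exists] at hc
    refine ht (isRelPrime_of_forall_prime hf fun p hp hpf hpt => ?_)
    obtain ⟨q, hq, hpq⟩ :=
      UniqueFactorizationMonoid.exists_mem_factors_of_dvd hf hp.irreducible hpf
    exact hc q (by simpa using hq) (hpq.symm.dvd.trans hpt)

theorem IsInvariant.mul {F : SingularFoliation} {a b : R2} (ha : IsInvariant F a)
    (hb : IsInvariant F b) : IsInvariant F (a * b) := by
  obtain ⟨h, hh⟩ := ha
  obtain ⟨k, hk⟩ := hb
  exact ⟨h + k, by rw [dx_mul, dy_mul]; linear_combination a * hk + b * hh⟩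

theorem isInvariant_of_isUnit (F : SingularFoliation) {u : R2} (hu : IsUnit u) :
    IsInvariant F u := hu.dvd

theorem isInvariant_of_irreducible_factors {F : SingularFoliation} {f : R2} (hf0 : f ≠ 0)
    (hf : ∀ b : R2, Irreducible b → b ∣ f → IsInvariant F b) : IsInvariant F f := by
  induction f using UniqueFactorizationMonoid.induction_on_prime with
  | h₁ => exact absurd rfl hf0
  | h₂ u hu => exact isInvariant_of_isUnit F hu
  | h₃ a p ha hp ih =>
    exact (hf p hp.irreducible (dvd_mul_right p a)).mul
      (ih ha fun b hb hba => hf b hb (hba.mul_left p))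

theorem IsCurveOfSeparatrices.ne_zero {F : SingularFoliation} {f : R2}
    (hf : IsCurveOfSeparatrices F f) : f ≠ 0 := hf.reduced.ne_zero

theorem IsCurveOfSeparatrices.of_dvd {F : SingularFoliation} {f a : R2}
    (hf : IsCurveOfSeparatrices F f) (h : a ∣ f) (ha : ¬ IsUnit a) :
    IsCurveOfSeparatrices F a where
  reduced := hf.reduced.squarefree_of_dvd h
  zero_mem := by rwa [isUnit_iff_constantCoeff_ne_zero, not_not] at ha
  isSeparatrix b hb hba := hf.isSeparatrix b hb (hba.trans h)

theorem IsSeparatrix.isCurveOfSeparatrices {F : SingularFoliation} {f : R2}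
    (hf : IsSeparatrix F f) : IsCurveOfSeparatrices F f where
  reduced := hf.1.squarefree
  zero_mem := by
    have := hf.1.not_isUnit
    rwa [isUnit_iff_constantCoeff_ne_zero, not_not] at this
  isSeparatrix b hb hbf := by
    refine ⟨hb, ?_⟩
    obtain ⟨u, hu⟩ := (hb.associated_of_dvd hf.1 hbf).symm
    rw [← hu]
    exact hf.2.mul (isInvariant_of_isUnit F u.isUnit)

theorem IsCurveOfSeparatrices.mul {F : SingularFoliation} {f₁ f₂ : R2}
    (h₁ : IsCurveOfSeparatrices F f₁) (h₂ : IsCurveOfSeparatrices F f₂)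
    (h₁₂ : IsRelPrime f₁ f₂) : IsCurveOfSeparatrices F (f₁ * f₂) where
  reduced := squarefree_mul_iff.mpr ⟨h₁₂, h₁.reduced, h₂.reduced⟩
  zero_mem := by rw [map_mul, h₁.zero_mem, zero_mul]
  isSeparatrix b hb hbf :=
    (hb.prime.dvd_or_dvd hbf).elim (h₁.isSeparatrix b hb) (h₂.isSeparatrix b hb)

/-- Take `g = ∂f/∂x + t ∂f/∂y` and `h = P + t Q` with the same generic `t`. Both `g P - h ∂f/∂x` and
`g Q - h ∂f/∂y` are scalar multiples of `P ∂f/∂y - Q ∂f/∂x`, which `f` divides by invariance. -/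
theorem exists_isDecomposition {F : SingularFoliation} {f : R2}
    (hf : IsCurveOfSeparatrices F f) : ∃ g h : R2, IsDecomposition F f g h := by
  have h1 := finite_setOf_not_isRelPrime hf.ne_zero fun p hp hpf =>
    not_dvd_dx_and_dvd_dy hf.reduced hp hpf
  have h2 := finite_setOf_not_isRelPrime (u := F.P) (v := F.Q) hf.ne_zero fun p hp _ hpPQ =>
    hp.not_isUnit (F.relPrime hpPQ.1 hpPQ.2)
  obtain ⟨t, ht⟩ := (h1.union h2).infinite_compl.nonempty
  simp only [Set.mem_compl_iff, Set.mem_union, Set.mem_ofPred_eq, not_or, not_not] at ht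
  obtain ⟨k, hk⟩ := isInvariant_of_irreducible_factors hf.ne_zero fun b hb hbf =>
    (hf.isSeparatrix b hb hbf).2
  exact ⟨_, _, ht.1, ht.2, MvPowerSeries.C t * k, -k,
    by linear_combination MvPowerSeries.C t * hk, by linear_combination -hk⟩

theorem finite_foliationTjurinaAlgebra (F : SingularFoliation) (f : R2) :
    Module.Finite ℂ (FoliationTjurinaAlgebra F f) :=
  have := finite_quotient_span_pair F.relPrime
  finite_quotient_of_le (Ideal.span_mono (Set.subset_insert _ _))

/-- A reduced plane curve singularity is isolated. -/
theorem finite_curveTjurinaAlgebra {f : R2} (hf : Squarefree f) :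
    Module.Finite ℂ (CurveTjurinaAlgebra f) := by
  obtain ⟨t, ht⟩ := (finite_setOf_not_isRelPrime hf.ne_zero fun p hp hpf =>
    not_dvd_dx_and_dvd_dy hf hp hpf).infinite_compl.nonempty
  have := finite_quotient_span_pair (not_not.mp ht)
  refine finite_quotient_of_le (I := Ideal.span {f, dx f + MvPowerSeries.C t * dy f}) (Ideal.span_le.mpr ?_)
  rintro _ (rfl | rfl)
  · exact Ideal.subset_span (Set.mem_insert _ _)
  · exact add_mem (Ideal.subset_span (by simp))
      (Ideal.mul_mem_left _ _ (Ideal.subset_span (by simp)))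

theorem span_triple_eq_of_add_mul (f a b u v : R2) :
    Ideal.span ({f, a + f * u, b + f * v} : Set R2) = Ideal.span {f, a, b} := by
  ext r
  simp only [Ideal.mem_span_insert, Ideal.mem_span_singleton']
  constructor
  · rintro ⟨x, _, ⟨y, _, ⟨z, rfl⟩, rfl⟩, rfl⟩
    exact ⟨x + y * u + z * v, _, ⟨y, _, ⟨z, rfl⟩, rfl⟩, by ring⟩
  · rintro ⟨x, _, ⟨y, _, ⟨z, rfl⟩, rfl⟩, rfl⟩
    exact ⟨x - y * u - z * v, _, ⟨y, _, ⟨z, rfl⟩, rfl⟩, by ring⟩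

/-- The difference of the Tjurina numbers is computed by any decomposition. -/
theorem IsDecomposition.foliationTjurina_sub_curveTjurina {F : SingularFoliation} {f g h : R2}
    (hd : IsDecomposition F f g h) (hf : Squarefree f) :
    (foliationTjurina F f : ℤ) - curveTjurina f =
      intersectionNumber f h - intersectionNumber f g := by
  obtain ⟨η₁, η₂, h1, h2⟩ := hd.eq
  have := finite_foliationTjurinaAlgebra F f
  have := finite_curveTjurinaAlgebra hf
  have k1 := finrank_quotient_span_mul hd.relPrime_g F.P F.Q
  have k2 := finrank_quotient_span_mul hd.relPrime_h (dx f) (dy f)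
  -- Both counts concern the same ideal, since the terms `f η₁`, `f η₂` are absorbed by the
  -- generator `f`.
  rw [h1, h2, span_triple_eq_of_add_mul, k2] at k1
  have e1 : foliationTjurina F f =
    Module.finrank ℂ (R2 ⧸ Ideal.span ({f, F.P, F.Q} : Set R2)) := rfl
  have e2 : curveTjurina f =
    Module.finrank ℂ (R2 ⧸ Ideal.span ({f, dx f, dy f} : Set R2)) := rfl
  omega

/-- In `h d(f₁ f₂) = h f₂ df₁ + f₁ h df₂` the second term is a multiple of `f₁` and joins the
remainder. -/
theorem IsDecomposition.of_mul {F : SingularFoliation} {f₁ f₂ g h : R2}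
    (hd : IsDecomposition F (f₁ * f₂) g h) (h₁₂ : IsRelPrime f₁ f₂) :
    IsDecomposition F f₁ g (h * f₂) where
  relPrime_g := hd.relPrime_g.of_mul_left_left
  relPrime_h := hd.relPrime_h.of_mul_left_left.mul_right h₁₂
  eq := by
    obtain ⟨η₁, η₂, h1, h2⟩ := hd.eq
    rw [dx_mul] at h1
    rw [dy_mul] at h2
    exact ⟨h * dx f₂ + f₂ * η₁, h * dy f₂ + f₂ * η₂, by linear_combination h1,
      by linear_combination h2⟩

/-- The behaviour of the difference of the Tjurina numbers under unions of curves. -/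
theorem foliationTjurina_sub_curveTjurina_mul {F : SingularFoliation} {f₁ f₂ : R2}
    (hf : IsCurveOfSeparatrices F (f₁ * f₂)) (h₁₂ : IsRelPrime f₁ f₂) :
    (foliationTjurina F (f₁ * f₂) : ℤ) - curveTjurina (f₁ * f₂) =
      ((foliationTjurina F f₁ : ℤ) - curveTjurina f₁) +
      ((foliationTjurina F f₂ : ℤ) - curveTjurina f₂) - 2 * intersectionNumber f₁ f₂ := by
  -- One decomposition along the union serves for all three curves; the extra factors `f₂` and `f₁`
  -- of `h` each contribute one `i(f₁, f₂)`.
  obtain ⟨g, h, hd⟩ := exists_isDecomposition hf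
  have hd' : IsDecomposition F (f₂ * f₁) g h := by rwa [mul_comm]
  have hs := squarefree_mul_iff.mp hf.reduced
  rw [hd.foliationTjurina_sub_curveTjurina hf.reduced,
    (hd.of_mul h₁₂).foliationTjurina_sub_curveTjurina hs.2.1,
    (hd'.of_mul h₁₂.symm).foliationTjurina_sub_curveTjurina hs.2.2,
    intersectionNumber_mul_left hd.relPrime_h.of_mul_left_left hd.relPrime_h.of_mul_left_right,
    intersectionNumber_mul_left hd.relPrime_g.of_mul_left_left hd.relPrime_g.of_mul_left_right,
    intersectionNumber_mul_right hd.relPrime_h.of_mul_left_left h₁₂,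
    intersectionNumber_mul_right hd.relPrime_h.of_mul_left_right h₁₂.symm,
    intersectionNumber_comm f₂ f₁]
  push_cast
  ring

/-- The rules `branch` and `union` already reach every curve, by induction on the prime factors. -/
theorem exists_isGSVIndex {F : SingularFoliation} {f : R2} (hf : IsCurveOfSeparatrices F f) :
    ∃ n : ℤ, IsGSVIndex F f n := by
  have hbranch : ∀ b : R2, IsSeparatrix F b → ∃ n : ℤ, IsGSVIndex F b n := fun b hb => by
    obtain ⟨g, h, hd⟩ := exists_isDecomposition hb.isCurveOfSeparatrices
    exact ⟨_, .branch hb hd⟩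
  induction f using UniqueFactorizationMonoid.induction_on_prime with
  | h₁ => exact absurd rfl hf.ne_zero
  | h₂ u hu => exact absurd hf.zero_mem (isUnit_iff_constantCoeff_ne_zero.mp hu)
  | h₃ a p ha hp ih =>
    -- A unit cofactor defines no curve through the origin; it is kept inside the last branch.
    by_cases hu : IsUnit a
    · have : Irreducible (p * a) := (irreducible_mul_isUnit hu).mpr hp.irreducible
      exact hbranch _ (hf.isSeparatrix _ this dvd_rfl)
    · obtain ⟨n, hn⟩ := ih (hf.of_dvd (dvd_mul_left a p) hu)
      obtain ⟨m, hm⟩ := hbranch p (hf.isSeparatrix p hp.irreducible (dvd_mul_right p a))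
      exact ⟨_, .union hm hn (squarefree_mul_iff.mp hf.reduced).1⟩

/-! ### Asymptotic expansions along a parametrization -/

/-- `F` has the formal power series `ψ` as asymptotic expansion at the origin. -/
def HasExpansion (F : ℂ → ℂ) (ψ : PowerSeries ℂ) : Prop :=
  ∀ N : ℕ, ∃ q : Polynomial ℂ, PowerSeries.X ^ N ∣ ψ - (q : PowerSeries ℂ) ∧
    (fun t => F t - q.eval t) =O[𝓝 0] fun t : ℂ => t ^ N

theorem isBigO_one_polynomial_eval (q : Polynomial ℂ) :
    (fun t => q.eval t) =O[𝓝 (0 : ℂ)] fun _ => (1 : ℂ) :=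
  q.continuous.continuousAt.isBigO_one ℂ

theorem HasExpansion.isBigO_one {F : ℂ → ℂ} {ψ : PowerSeries ℂ} (h : HasExpansion F ψ) :
    F =O[𝓝 0] fun _ => (1 : ℂ) := by
  obtain ⟨q, -, hq⟩ := h 0
  simp only [pow_zero] at hq
  exact (hq.add (isBigO_one_polynomial_eval q)).congr_left fun t => sub_add_cancel _ _

theorem HasExpansion.const (c : ℂ) : HasExpansion (fun _ => c) (PowerSeries.C c) := fun N =>
  ⟨Polynomial.C c, by simp, by simpa using Asymptotics.isBigO_zero _ _⟩

theorem HasExpansion.add {F G : ℂ → ℂ} {φ ψ : PowerSeries ℂ} (hF : HasExpansion F φ)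
    (hG : HasExpansion G ψ) : HasExpansion (fun t => F t + G t) (φ + ψ) := fun N => by
  obtain ⟨p, hp, hp'⟩ := hF N
  obtain ⟨q, hq, hq'⟩ := hG N
  refine ⟨p + q, ?_, ?_⟩
  · rw [Polynomial.coe_add, add_sub_add_comm]
    exact dvd_add hp hq
  · simpa only [Polynomial.eval_add, add_sub_add_comm] using hp'.add hq'

theorem HasExpansion.mul {F G : ℂ → ℂ} {φ ψ : PowerSeries ℂ} (hF : HasExpansion F φ)
    (hG : HasExpansion G ψ) : HasExpansion (fun t => F t * G t) (φ * ψ) := fun N => by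
  obtain ⟨p, hp, hp'⟩ := hF N
  obtain ⟨q, hq, hq'⟩ := hG N
  refine ⟨p * q, ?_, ?_⟩
  · have : φ * ψ - ((p * q : Polynomial ℂ) : PowerSeries ℂ) =
        φ * (ψ - (q : PowerSeries ℂ)) + (q : PowerSeries ℂ) * (φ - (p : PowerSeries ℂ)) := by
      rw [Polynomial.coe_mul]
      ring
    rw [this]
    exact dvd_add (hq.mul_left _) (hp.mul_left _)
  · have h1 := hF.isBigO_one.mul hq'
    have h2 := (isBigO_one_polynomial_eval q).mul hp'
    simp only [one_mul] at h1 h2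
    refine (h1.add h2).congr_left fun t => ?_
    rw [Polynomial.eval_mul]
    ring

theorem HasExpansion.pow {F : ℂ → ℂ} {φ : PowerSeries ℂ} (hF : HasExpansion F φ) (n : ℕ) :
    HasExpansion (fun t => F t ^ n) (φ ^ n) := by
  induction n with
  | zero => simpa using HasExpansion.const 1
  | succ n ih => simpa only [pow_succ] using ih.mul hF

theorem HasExpansion.sum {ι : Type*} (s : Finset ι) {F : ι → ℂ → ℂ} {φ : ι → PowerSeries ℂ}
    (h : ∀ i ∈ s, HasExpansion (F i) (φ i)) :
    HasExpansion (fun t => ∑ i ∈ s, F i t) (∑ i ∈ s, φ i) := by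
  classical
  induction s using Finset.induction_on with
  | empty => simpa using HasExpansion.const 0
  | insert a s ha ih =>
    simp only [Finset.sum_insert ha]
    exact (h a (Finset.mem_insert_self a s)).add
      (ih fun i hi => h i (Finset.mem_insert_of_mem hi))

/-- A differentiable function with a nonzero asymptotic expansion of order `m` is the product of
`t ^ m` and a nonvanishing analytic function. -/
theorem HasExpansion.exists_eq_pow_mul {F : ℂ → ℂ} {ψ : PowerSeries ℂ} (h : HasExpansion F ψ)
    (hψ : ψ ≠ 0) (hF : ∀ᶠ t in 𝓝[≠] 0, DifferentiableAt ℂ F t) :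
    ∃ w : ℂ → ℂ, AnalyticAt ℂ w 0 ∧ w 0 ≠ 0 ∧ ∀ᶠ t in 𝓝[≠] 0, F t = t ^ ψ.order.toNat * w t := by
  set m := ψ.order.toNat with hm
  -- One order beyond `m`: `q` then has the leading term of `ψ`, and the error divided by `t ^ m`
  -- still tends to zero.
  obtain ⟨q, hq, hq'⟩ := h (m + 1)
  have hcoeff : ∀ k ≤ m, q.coeff k = PowerSeries.coeff k ψ := fun k hk => by
    have := PowerSeries.X_pow_dvd_iff.mp hq k (Nat.lt_succ_of_le hk)
    rw [map_sub, Polynomial.coeff_coe, sub_eq_zero] at this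
    exact this.symm
  obtain ⟨p, rfl⟩ : Polynomial.X ^ m ∣ q := Polynomial.X_pow_dvd_iff.mpr fun k hk => by
    rw [hcoeff k hk.le, PowerSeries.coeff_of_lt_order_toNat k hk]
  have hp0 : p.eval 0 ≠ 0 := by
    have := hcoeff m le_rfl
    rw [← Polynomial.coeff_zero_eq_eval_zero, ← Polynomial.coeff_X_pow_mul p m 0, zero_add, this]
    exact PowerSeries.coeff_order hψ
  -- Riemann's removable singularity theorem applies to `F t / t ^ m`, whose limit at the origin is
  -- `p.eval 0`.
  let w : ℂ → ℂ := Function.update (fun t => F t / t ^ m) 0 (p.eval 0)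
  have hw : ∀ t ≠ 0, w t = F t / t ^ m := fun t ht => Function.update_of_ne ht _ _
  have hne : ∀ᶠ t : ℂ in 𝓝[≠] 0, t ≠ 0 := eventually_mem_nhdsWithin
  have hlim : Filter.Tendsto (fun t => F t / t ^ m) (𝓝[≠] 0) (𝓝 (p.eval 0)) := by
    have h1 : (fun t => F t / t ^ m - p.eval t) =O[𝓝[≠] 0] fun t : ℂ => t := by
      have h2 := (hq'.mono (nhdsWithin_le_nhds (s := {0}ᶜ))).mul
        (Asymptotics.isBigO_refl (fun t : ℂ => (t ^ m)⁻¹) _)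
      refine h2.congr' (hne.mono fun t ht => ?_) (hne.mono fun t ht => ?_)
      · simp only [Polynomial.eval_mul, Polynomial.eval_pow, Polynomial.eval_X]
        field_simp
      · simp only
        field_simp
        ring
    have h2 : Filter.Tendsto (fun t : ℂ => t) (𝓝[≠] 0) (𝓝 0) :=
      Filter.tendsto_id.mono_left nhdsWithin_le_nhds
    have h3 : Filter.Tendsto (fun t => p.eval t) (𝓝[≠] (0 : ℂ)) (𝓝 (p.eval 0)) :=
      p.continuous.continuousAt.tendsto.mono_left nhdsWithin_le_nhds
    simpa using (h1.trans_tendsto h2).add h3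
  refine ⟨w, Complex.analyticAt_of_differentiable_on_punctured_nhds_of_continuousAt ?_
    (continuousAt_update_same.mpr hlim), by simpa [w] using hp0, ?_⟩
  · filter_upwards [hF, hne] with t ht ht0
    have : w =ᶠ[𝓝 t] fun t => F t / t ^ m :=
      (eventually_ne_nhds ht0).mono fun s hs => hw s hs
    exact this.differentiableAt_iff.mpr
      (ht.div (differentiableAt_id.pow m) (pow_ne_zero m ht0))
  · filter_upwards [hne] with t ht
    rw [hw t ht]
    field_simp

/-- The tail of a series whose terms are dominated by a weighted power. -/
theorem norm_tsum_sub_sum_le {ι : Type*} {T : ι → ℂ} {a : ι → ℝ} (ha : Summable a)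
    (ha0 : ∀ i, 0 ≤ a i) {deg : ι → ℕ} {x : ℝ} (hx0 : 0 ≤ x) (hx1 : x ≤ 1)
    (hT : ∀ i, ‖T i‖ ≤ a i * x ^ deg i) {s : Finset ι} {N : ℕ} (hs : ∀ i ∉ s, N ≤ deg i) :
    ‖∑' i, T i - ∑ i ∈ s, T i‖ ≤ (∑' i, a i) * x ^ N := by
  classical
  have hsum : Summable T := Summable.of_norm_bounded ha fun i =>
    (hT i).trans (mul_le_of_le_one_right (ha0 i) (pow_le_one₀ hx0 hx1))
  let T' : ι → ℂ := fun i => if i ∈ s then 0 else T i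
  have hT' : ∑' i, T i - ∑ i ∈ s, T i = ∑' i, T' i := by
    have h1 : HasSum (fun i => if i ∈ s then T i else 0) (∑ i ∈ s, T i) := by
      have : HasSum (fun i => if i ∈ s then T i else 0) (∑ i ∈ s, if i ∈ s then T i else 0) :=
        hasSum_sum_of_ne_finset_zero fun i hi => if_neg hi
      rwa [Finset.sum_congr rfl fun i hi => if_pos hi] at this
    have h2 : T' = fun i => T i - if i ∈ s then T i else 0 := by
      ext i
      simp only [T']
      split_ifs <;> simp
    rw [h2, (hsum.hasSum.sub h1).tsum_eq]
  rw [hT']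
  refine tsum_of_norm_bounded (ha.hasSum.mul_right (x ^ N)) fun i => ?_
  simp only [T']
  split_ifs with hi
  · rw [norm_zero]
    exact mul_nonneg (ha0 i) (pow_nonneg hx0 N)
  · exact (hT i).trans (mul_le_mul_of_nonneg_left (pow_le_pow_of_le_one hx0 hx1 (hs i hi)) (ha0 i))

theorem hasExpansion_value₁ {φ : PowerSeries ℂ} (hφ : IsConvergent₁ φ) :
    HasExpansion (value₁ φ) φ := fun N => by
  obtain ⟨r, hr, hs⟩ := hφ
  refine ⟨PowerSeries.trunc N φ, ?_, ?_⟩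
  · rw [PowerSeries.X_pow_dvd_iff]
    intro k hk
    rw [map_sub, Polynomial.coeff_coe, PowerSeries.coeff_trunc, if_pos hk, sub_self]
  · refine Asymptotics.IsBigO.of_bound
      ((∑' n : ℕ, ‖PowerSeries.coeff n φ‖ * r ^ n) * (r ^ N)⁻¹) ?_
    filter_upwards [Metric.closedBall_mem_nhds (0 : ℂ) hr] with t ht
    rw [mem_closedBall_zero_iff] at ht
    have h1 : (PowerSeries.trunc N φ).eval t =
        ∑ n ∈ Finset.range N, PowerSeries.coeff n φ * t ^ n := by
      simpa using PowerSeries.eval₂_trunc_eq_sum_range t (RingHom.id ℂ) N φ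
    rw [h1]
    -- Scaling by the radius `r` turns the `n`-th term into a summable weight times `(‖t‖ / r) ^ n`.
    refine (norm_tsum_sub_sum_le (deg := fun n => n) (x := ‖t‖ / r) (N := N) hs
      (fun n => by positivity) (by positivity) ((div_le_one hr).mpr ht) (fun n => ?_)
      (fun n hn => by simpa using hn)).trans_eq ?_
    · rw [norm_mul, norm_pow, div_pow]
      field_simp
      rfl
    · rw [norm_pow, div_pow]
      field_simp

theorem differentiableOn_value₁ {φ : PowerSeries ℂ} (hφ : IsConvergent₁ φ) :
    ∃ r > 0, DifferentiableOn ℂ (value₁ φ) (Metric.ball 0 r) := by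
  obtain ⟨r, hr, hs⟩ := hφ
  refine ⟨r, hr, Complex.differentiableOn_tsum_of_summable_norm hs (fun n => by fun_prop)
    Metric.isOpen_ball fun n t ht => ?_⟩
  rw [mem_ball_zero_iff] at ht
  rw [norm_mul, norm_pow]
  gcongr

theorem isBigO_value₁ {φ : PowerSeries ℂ} (hφ : IsConvergent₁ φ)
    (h0 : PowerSeries.constantCoeff φ = 0) :
    (fun t => value₁ φ t) =O[𝓝 0] fun t : ℂ => t := by
  obtain ⟨q, hq, hq'⟩ := hasExpansion_value₁ hφ 1
  have h1 : (fun t => q.eval t) =O[𝓝 0] fun t : ℂ => t := by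
    obtain ⟨p, rfl⟩ : Polynomial.X ∣ q := by
      rw [Polynomial.X_dvd_iff]
      have := PowerSeries.X_pow_dvd_iff.mp hq 0 one_pos
      simpa [h0] using this
    simpa using (Asymptotics.isBigO_refl (fun t : ℂ => t) (𝓝 0)).mul (isBigO_one_polynomial_eval p)
  simp only [pow_one] at hq'
  exact (hq'.add h1).congr_left fun t => sub_add_cancel _ _

/-! ### The loop integral -/

section Parametrization

variable {γ : Fin 2 → PowerSeries ℂ}

/-- Near the origin both coordinates of `γ(t)` are bounded by `M ‖t‖`. -/
theorem exists_norm_value₁_le (h0 : ∀ i, PowerSeries.constantCoeff (γ i) = 0)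
    (hc : ∀ i, IsConvergent₁ (γ i)) :
    ∃ M > 0, ∀ᶠ t : ℂ in 𝓝 0, ∀ i, ‖value₁ (γ i) t‖ ≤ M * ‖t‖ := by
  obtain ⟨A, hA, hA'⟩ := (isBigO_value₁ (hc 0) (h0 0)).exists_pos
  obtain ⟨B, hB, hB'⟩ := (isBigO_value₁ (hc 1) (h0 1)).exists_pos
  refine ⟨A + B, by positivity, ?_⟩
  filter_upwards [hA'.bound, hB'.bound] with t hAt hBt i
  have hA1 : 0 ≤ A * ‖t‖ := by positivity
  have hB1 : 0 ≤ B * ‖t‖ := by positivity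
  rw [add_mul]
  fin_cases i
  · exact hAt.trans (by linarith)
  · exact hBt.trans (by linarith)

theorem pullback_term_norm_le {c : ℂ} {z w : ℂ} {r x : ℝ} (hr : 0 < r) (hx : 0 ≤ x)
    (hz : ‖z‖ ≤ x * r) (hw : ‖w‖ ≤ x * r) (a b : ℕ) :
    ‖c * (z ^ a * w ^ b)‖ ≤ ‖c‖ * r ^ (a + b) * x ^ (a + b) := by
  rw [norm_mul, norm_mul, norm_pow, norm_pow]
  calc ‖c‖ * (‖z‖ ^ a * ‖w‖ ^ b) ≤ ‖c‖ * ((x * r) ^ a * (x * r) ^ b) := by gcongr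
    _ = ‖c‖ * r ^ (a + b) * x ^ (a + b) := by ring

/-- This ties the function `t ↦ g(γ(t))` to the formal substitution `γ* g`, so that analytic and
formal orders of vanishing agree. -/
theorem hasExpansion_pullback (h0 : ∀ i, PowerSeries.constantCoeff (γ i) = 0)
    (hc : ∀ i, IsConvergent₁ (γ i)) {g : R2} (hg : IsConvergent₂ g) :
    HasExpansion (pullback γ g) (MvPowerSeries.subst γ g) := fun N => by
  classical
  have hsub : MvPowerSeries.HasSubst γ := MvPowerSeries.hasSubst_of_constantCoeff_zero h0
  let S : R2 →ₐ[ℂ] PowerSeries ℂ := MvPowerSeries.substAlgHom hsub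
  have hS : ∀ u, S u = MvPowerSeries.subst γ u := fun u => by simp [S]
  -- Truncation to a box: monomials outside it lie in `(x ^ N, y ^ N)`, which `γ*` sends into
  -- multiples of `X ^ N`, and their values along `γ` add up to `O(t ^ N)`.
  let s : Finset (Fin 2 →₀ ℕ) := Finset.Iic (Finsupp.single 0 N + Finsupp.single 1 N)
  have hs : ∀ n, n ∈ s ↔ n 0 ≤ N ∧ n 1 ≤ N := fun n => by
    simp [s, Finset.mem_Iic, Finsupp.le_def, Fin.forall_fin_two]
  let G : ℂ → ℂ := fun t => ∑ n ∈ s,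
    MvPowerSeries.coeff n g * (value₁ (γ 0) t ^ n 0 * value₁ (γ 1) t ^ n 1)
  let ψ : PowerSeries ℂ := ∑ n ∈ s,
    PowerSeries.C (MvPowerSeries.coeff n g) * (γ 0 ^ n 0 * γ 1 ^ n 1)
  have hG : HasExpansion G ψ := HasExpansion.sum s fun n _ => (HasExpansion.const _).mul
    (((hasExpansion_value₁ (hc 0)).pow _).mul ((hasExpansion_value₁ (hc 1)).pow _))
  obtain ⟨q, hq, hq'⟩ := hG N
  refine ⟨q, ?_, ?_⟩
  · let p : R2 := ∑ n ∈ s, MvPowerSeries.monomial n (MvPowerSeries.coeff n g)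
    have hp : S p = ψ := by
      rw [map_sum]
      refine Finset.sum_congr rfl fun n _ => ?_
      rw [hS, MvPowerSeries.subst_monomial hsub, Finsupp.prod_fintype _ _ (by simp),
        Fin.prod_univ_two]
      rfl
    have hgp : g - p ∈ Ideal.span ({MvPowerSeries.X 0 ^ N, MvPowerSeries.X 1 ^ N} : Set R2) := by
      refine mem_span_X_pow fun n hn0 hn1 => ?_
      have hn : n ∈ s := (hs n).mpr ⟨hn0.le, hn1.le⟩
      simp [p, MvPowerSeries.coeff_monomial, Finset.sum_ite_eq, hn]
    obtain ⟨a, b, hab⟩ := Ideal.mem_span_pair.mp hgp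
    have hX : ∀ i, PowerSeries.X ^ N ∣ S (MvPowerSeries.X i ^ N) := fun i => by
      rw [map_pow, hS, MvPowerSeries.subst_X hsub]
      exact pow_dvd_pow_of_dvd (PowerSeries.X_dvd_iff.mpr (h0 i)) N
    have h1 : PowerSeries.X ^ N ∣ S (g - p) := by
      rw [← hab, map_add, map_mul, map_mul]
      exact dvd_add ((hX 0).mul_left _) ((hX 1).mul_left _)
    have h2 : MvPowerSeries.subst γ g - (q : PowerSeries ℂ) =
        S (g - p) + (ψ - (q : PowerSeries ℂ)) := by
      rw [map_sub, hp, hS]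
      ring
    rw [h2]
    exact dvd_add h1 hq
  · have h1 : (fun t => pullback γ g t - G t) =O[𝓝 0] fun t : ℂ => t ^ N := by
      obtain ⟨r, hr, hsum⟩ := hg
      obtain ⟨M, hM, hMt⟩ := exists_norm_value₁_le h0 hc
      refine Asymptotics.IsBigO.of_bound ((∑' n : Fin 2 →₀ ℕ,
        ‖MvPowerSeries.coeff n g‖ * r ^ (n 0 + n 1)) * (M / r) ^ N) ?_
      filter_upwards [hMt, Metric.closedBall_mem_nhds (0 : ℂ) (div_pos hr hM)] with t ht htr
      rw [mem_closedBall_zero_iff, le_div_iff₀ hM] at htr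
      have hxr : ∀ i, ‖value₁ (γ i) t‖ ≤ M * ‖t‖ / r * r := fun i => by
        rw [div_mul_cancel₀ _ hr.ne']
        exact ht i
      refine (norm_tsum_sub_sum_le (deg := fun n : Fin 2 →₀ ℕ => n 0 + n 1) (x := M * ‖t‖ / r)
        (N := N) hsum (fun n => by positivity) (by positivity)
        ((div_le_one hr).mpr (by linarith)) (fun n => ?_) (fun n hn => ?_)).trans_eq ?_
      · exact pullback_term_norm_le hr (by positivity) (hxr 0) (hxr 1) _ _
      · rw [hs, not_and_or] at hn
        omega
      · rw [norm_pow, mul_div_right_comm, mul_pow]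
        ring
    exact (h1.add hq').congr_left fun t => sub_add_sub_cancel _ _ _

/-- For `‖t‖ < r / M` the point `γ(t)` stays in the polydisc of radius `r`, where the series of
holomorphic terms converges normally. -/
theorem eventually_differentiableAt_pullback (h0 : ∀ i, PowerSeries.constantCoeff (γ i) = 0)
    (hc : ∀ i, IsConvergent₁ (γ i)) {g : R2} (hg : IsConvergent₂ g) :
    ∀ᶠ t in 𝓝 0, DifferentiableAt ℂ (pullback γ g) t := by
  obtain ⟨r, hr, hsum⟩ := hg
  obtain ⟨M, hM, hMt⟩ := exists_norm_value₁_le h0 hc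
  obtain ⟨ρ₀, hρ₀, hd₀⟩ := differentiableOn_value₁ (hc 0)
  obtain ⟨ρ₁, hρ₁, hd₁⟩ := differentiableOn_value₁ (hc 1)
  obtain ⟨δ, hδ, hδt⟩ := Metric.eventually_nhds_iff_ball.mp hMt
  have hU : DifferentiableOn ℂ (pullback γ g)
      (Metric.ball 0 ρ₀ ∩ Metric.ball 0 ρ₁ ∩ Metric.ball 0 δ ∩ Metric.ball 0 (r / M)) := by
    refine Complex.differentiableOn_tsum_of_summable_norm hsum (fun n => ?_) (by
      exact ((Metric.isOpen_ball.inter Metric.isOpen_ball).inter Metric.isOpen_ball).inter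
        Metric.isOpen_ball) fun n t ht => ?_
    · refine (differentiableOn_const _).mul (.mul (.pow (hd₀.mono ?_) _) (.pow (hd₁.mono ?_) _))
      · exact fun t ht => ht.1.1.1
      · exact fun t ht => ht.1.1.2
    · have h1 := ht.2
      rw [mem_ball_zero_iff, lt_div_iff₀ hM] at h1
      have hb : ∀ i, ‖value₁ (γ i) t‖ ≤ 1 * r := fun i =>
        (hδt t ht.1.2 i).trans (by linarith)
      simpa using pullback_term_norm_le (c := MvPowerSeries.coeff n g) hr zero_le_one
        (hb 0) (hb 1) (n 0) (n 1)
  filter_upwards [Filter.inter_mem (Filter.inter_mem (Filter.inter_mem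
    (Metric.ball_mem_nhds 0 hρ₀) (Metric.ball_mem_nhds 0 hρ₁)) (Metric.ball_mem_nhds 0 hδ))
    (Metric.ball_mem_nhds 0 (div_pos hr hM))] with t ht
  exact hU.differentiableAt ((((Metric.isOpen_ball.inter Metric.isOpen_ball).inter
    Metric.isOpen_ball).inter Metric.isOpen_ball).mem_nhds ht)

end Parametrization

/-- The residue of `d log (H / G)` at the origin. -/
theorem circleIntegral_logDeriv {G H u v : ℂ → ℂ} {a b : ℕ} (hu : AnalyticAt ℂ u 0) (hu0 : u 0 ≠ 0)
    (hv : AnalyticAt ℂ v 0) (hv0 : v 0 ≠ 0) (hG : ∀ᶠ t in 𝓝[≠] 0, G t = t ^ a * u t)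
    (hH : ∀ᶠ t in 𝓝[≠] 0, H t = t ^ b * v t) :
    ∀ᶠ ε : ℝ in 𝓝[>] 0, (∮ t in C(0, ε), G t / H t * deriv (fun s => H s / G s) t) =
      2 * Real.pi * Complex.I * ((b : ℂ) - a) := by
  have hev : ∀ᶠ t : ℂ in 𝓝 0, (t ≠ 0 → G t = t ^ a * u t) ∧ (t ≠ 0 → H t = t ^ b * v t) ∧
      AnalyticAt ℂ u t ∧ AnalyticAt ℂ v t ∧ u t ≠ 0 ∧ v t ≠ 0 := by
    filter_upwards [eventually_nhdsWithin_iff.mp hG, eventually_nhdsWithin_iff.mp hH,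
      hu.eventually_analyticAt, hv.eventually_analyticAt, hu.continuousAt.eventually_ne hu0,
      hv.continuousAt.eventually_ne hv0] with t h1 h2 h3 h4 h5 h6
    exact ⟨h1, h2, h3, h4, h5, h6⟩
  obtain ⟨ρ, hρ, hball⟩ := Metric.eventually_nhds_iff_ball.mp hev
  filter_upwards [Ioo_mem_nhdsGT hρ] with ε hε
  have hsub : Metric.closedBall (0 : ℂ) ε ⊆ Metric.ball 0 ρ :=
    Metric.closedBall_subset_ball hε.2
  -- The logarithmic derivative of `H / G` is `(b - a) / t + L`, and the holomorphic part `L`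
  -- integrates to zero.
  let L : ℂ → ℂ := fun t => deriv v t / v t - deriv u t / u t
  have hL : DifferentiableOn ℂ L (Metric.ball 0 ρ) := fun t ht => by
    obtain ⟨-, -, h3, h4, h5, h6⟩ := hball t ht
    exact ((h4.deriv.differentiableAt.div h4.differentiableAt h6).sub
      (h3.deriv.differentiableAt.div h3.differentiableAt h5)).differentiableWithinAt
  have hL0 : (∮ t in C(0, ε), L t) = 0 :=
    Complex.circleIntegral_eq_zero_of_differentiable_on_off_countable hε.1.le
      Set.countable_empty (hL.continuousOn.mono hsub) fun t ht =>
        hL.differentiableAt (Metric.isOpen_ball.mem_nhds (hsub (Metric.ball_subset_closedBall ht.1)))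
  have hcongr : Set.EqOn (fun t => G t / H t * deriv (fun s => H s / G s) t)
      (fun t => ((b : ℂ) - a) * (t - 0)⁻¹ + L t) (Metric.sphere 0 ε) := fun t ht => by
    have ht0 : t ≠ 0 := by
      rintro rfl
      rw [mem_sphere_zero_iff_norm, norm_zero] at ht
      exact hε.1.ne ht
    have htb : t ∈ Metric.ball 0 ρ := hsub (Metric.sphere_subset_closedBall ht)
    obtain ⟨h1, h2, h3, h4, h5, h6⟩ := hball t htb
    have hloc : (fun s => H s / G s) =ᶠ[𝓝 t] fun s => (s ^ b * v s) / (s ^ a * u s) := by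
      filter_upwards [eventually_ne_nhds ht0, Metric.isOpen_ball.mem_nhds htb] with s hs0 hs
      rw [(hball s hs).1 hs0, (hball s hs).2.1 hs0]
    have hA : DifferentiableAt ℂ (fun s : ℂ => s ^ a) t := by fun_prop
    have hB : DifferentiableAt ℂ (fun s : ℂ => s ^ b) t := by fun_prop
    have hlog : logDeriv (fun s => (s ^ b * v s) / (s ^ a * u s)) t =
        ((b : ℂ) - a) * (t - 0)⁻¹ + L t := by
      rw [logDeriv_div (f := fun s => s ^ b * v s) (g := fun s => s ^ a * u s) t
        (mul_ne_zero (pow_ne_zero b ht0) h6) (mul_ne_zero (pow_ne_zero a ht0) h5)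
        (hB.mul h4.differentiableAt) (hA.mul h3.differentiableAt),
        logDeriv_mul (f := fun s : ℂ => s ^ b) t (pow_ne_zero b ht0) h6 hB h4.differentiableAt,
        logDeriv_mul (f := fun s : ℂ => s ^ a) t (pow_ne_zero a ht0) h5 hA h3.differentiableAt, logDeriv_pow, logDeriv_pow]
      simp only [L, logDeriv_apply, sub_zero]
      ring
    simp only
    rw [← hlog, logDeriv_apply, ← hloc.deriv_eq, ← hloc.eq_of_nhds, div_eq_mul_inv _ (H t / G t),
      inv_div, mul_comm]
  have hi1 : CircleIntegrable (fun t : ℂ => ((b : ℂ) - a) * (t - 0)⁻¹) 0 ε := by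
    refine ContinuousOn.circleIntegrable hε.1.le (continuousOn_const.mul
      (ContinuousOn.inv₀ (by fun_prop) fun t ht => ?_))
    rw [sub_zero]
    rintro rfl
    rw [mem_sphere_zero_iff_norm, norm_zero] at ht
    exact hε.1.ne ht
  have hi2 : CircleIntegrable L 0 ε := ContinuousOn.circleIntegrable hε.1.le
    (hL.continuousOn.mono (Metric.sphere_subset_closedBall.trans hsub))
  rw [circleIntegral.integral_congr hε.1.le hcongr, circleIntegral.integral_add hi1 hi2, hL0,
    add_zero, circleIntegral.integral_const_mul, circleIntegral.integral_sub_center_inv 0 hε.1.ne']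
  ring

theorem IsParametrization.subst_ne_zero {b g : R2} {γ : Fin 2 → PowerSeries ℂ}
    (hγ : IsParametrization b γ) (hb : ¬ IsUnit b) (hbg : IsRelPrime b g) :
    (MvPowerSeries.subst γ g : PowerSeries ℂ) ≠ 0 := fun h =>
  hb (hbg dvd_rfl ((hγ.ker g).mp h))

/-- The integral of `(g / h) d(h / g)` over a small loop around a branch of a curve. -/
theorem IsParametrization.loopIntegral_eq {b g h : R2} {γ : Fin 2 → PowerSeries ℂ}
    (hγ : IsParametrization b γ) (hb : ¬ IsUnit b) (hbg : IsRelPrime b g) (hbh : IsRelPrime b h)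
    (hg : IsConvergent₂ g) (hh : IsConvergent₂ h) :
    ∀ᶠ ε : ℝ in 𝓝[>] 0, loopIntegral g h γ ε =
      2 * Real.pi * Complex.I * ((intersectionNumber b h : ℂ) - intersectionNumber b g) := by
  have hexp : ∀ k : R2, IsRelPrime b k → IsConvergent₂ k → ∃ w : ℂ → ℂ, AnalyticAt ℂ w 0 ∧
      w 0 ≠ 0 ∧ ∀ᶠ t in 𝓝[≠] 0, pullback γ k t = t ^ intersectionNumber b k * w t := by
    intro k hbk hk
    have hk0 := hγ.subst_ne_zero hb hbk
    rw [hγ.intersectionNumber_eq hbk hk0]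
    exact (hasExpansion_pullback hγ.centered hγ.convergent hk).exists_eq_pow_mul hk0
      ((eventually_differentiableAt_pullback hγ.centered hγ.convergent hk).filter_mono
        nhdsWithin_le_nhds)
  obtain ⟨u, hu, hu0, hgu⟩ := hexp g hbg hg
  obtain ⟨v, hv, hv0, hhv⟩ := hexp h hbh hh
  exact circleIntegral_logDeriv hu hu0 hv hv0 hgu hhv

/-! ### The index is the difference of the Tjurina numbers -/

/-- The residues `i(bᵢ, h) - i(bᵢ, g)` of the branches add up by additivity of intersection numbers.
-/
theorem analytic_index_eq {f g h : R2} {r : ℕ} {b : Fin r → R2} {γ : Fin r → Fin 2 → PowerSeries ℂ}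
    {n : ℤ} (hfg : IsRelPrime f g) (hfh : IsRelPrime f h)
    (hgc : IsConvergent₂ g) (hhc : IsConvergent₂ h) (hb : ∀ i, Irreducible (b i))
    (hfb : f = ∏ i, b i) (hγ : ∀ i, IsParametrization (b i) (γ i))
    (hn : ∀ᶠ ε : ℝ in 𝓝[>] 0,
      (2 * (Real.pi : ℂ) * Complex.I)⁻¹ * ∑ i, loopIntegral g h (γ i) ε = (n : ℂ)) :
    n = (intersectionNumber f h : ℤ) - intersectionNumber f g := by
  have hdvd : ∀ i, b i ∣ f := fun i => hfb ▸ Finset.dvd_prod_of_mem b (Finset.mem_univ i)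
  have hbg : ∀ i, IsRelPrime (b i) g := fun i => hfg.of_dvd_left (hdvd i)
  have hbh : ∀ i, IsRelPrime (b i) h := fun i => hfh.of_dvd_left (hdvd i)
  have hloop := Filter.eventually_all.mpr fun i =>
    (hγ i).loopIntegral_eq (hb i).not_isUnit (hbg i) (hbh i) hgc hhc
  -- A single radius that is small enough for all branches at once determines `n`.
  obtain ⟨ε, hε, hε'⟩ := (hn.and hloop).exists
  rw [Finset.sum_congr rfl fun i _ => hε' i, ← Finset.mul_sum,
    inv_mul_cancel_left₀ Complex.two_pi_I_ne_zero, Finset.sum_sub_distrib] at hε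
  rw [hfb, intersectionNumber_prod_left _ _ fun i _ => hbg i,
    intersectionNumber_prod_left _ _ fun i _ => hbh i]
  push_cast
  exact_mod_cast hε.symm

/-- Induction on how the index was obtained. The first conjunct is carried along because the rule
`union` does not assume it, while the formula for unions needs it. Since the left side of the
equation does not involve `n`, the index is unique. -/
theorem IsGSVIndex.isCurveOfSeparatrices_and_eq {F : SingularFoliation} {f : R2} {n : ℤ}
    (h : IsGSVIndex F f n) : IsCurveOfSeparatrices F f ∧
      (foliationTjurina F f : ℤ) - curveTjurina f = n := by
  induction h with
  | analytic hf hd _ hgc hhc hb hfb hγ hn =>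
    refine ⟨hf, ?_⟩
    rw [hd.foliationTjurina_sub_curveTjurina hf.reduced,
      analytic_index_eq hd.relPrime_g hd.relPrime_h hgc hhc hb hfb hγ hn]
  | branch hf hd =>
    exact ⟨hf.isCurveOfSeparatrices, hd.foliationTjurina_sub_curveTjurina hf.1.squarefree⟩
  | union _ _ h₁₂ ih₁ ih₂ =>
    have hf := ih₁.1.mul ih₂.1 h₁₂
    refine ⟨hf, ?_⟩
    rw [foliationTjurina_sub_curveTjurina_mul hf h₁₂, ih₁.2, ih₂.2]

end PlaneFoliation

end

theorem mainTheorem5 (F : PlaneFoliation.SingularFoliation) (f : PlaneFoliation.R2)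
    (hf : PlaneFoliation.IsCurveOfSeparatrices F f) :
    Module.Finite ℂ (PlaneFoliation.FoliationTjurinaAlgebra F f) ∧
    Module.Finite ℂ (PlaneFoliation.CurveTjurinaAlgebra f) ∧
    (∃! n : ℤ, PlaneFoliation.IsGSVIndex F f n) ∧
    ∀ n : ℤ, PlaneFoliation.IsGSVIndex F f n →
      (PlaneFoliation.foliationTjurina F f : ℤ) - (PlaneFoliation.curveTjurina f : ℤ) = n := by
  obtain ⟨n, hn⟩ := PlaneFoliation.exists_isGSVIndex hf
  exact ⟨PlaneFoliation.finite_foliationTjurinaAlgebra F f,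
    PlaneFoliation.finite_curveTjurinaAlgebra hf.reduced,
    ⟨n, hn, fun m hm =>
      hm.isCurveOfSeparatrices_and_eq.2.symm.trans hn.isCurveOfSeparatrices_and_eq.2⟩,
    fun m hm => hm.isCurveOfSeparatrices_and_eq.2⟩
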